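/- Let $\mathcal A$ be a finite alphabet, let $\mathcal A^{\mathbb Z}$ carry the product topology and the left shift $\sigma$, and let $\mathcal G$ be a set of finite words over $\mathcal A$. For integers $n<m$ write $x[n,m)=x_n\cdots x_{m-1}$ and $x[n,m]=x_n\cdots x_m$. Let $$X_{\rm seq}=\{x\in\mathcal A^{\mathbb Z}:\ \text{there are integers } \cdots<k_{-1}<k_0<k_1<\cdots \text{ with } x[k_i,k_{i+1})\in\mathcal G \text{ for all } i\in\mathbb Z\},$$ let $X=X(\mathcal G)$ be the closure of $X_{\rm seq}$ (the coded shift generated by $\mathcal G$), let $X_{\rm res}=X\setminus X_{\rm seq}$, and let $$X_{\rm lim}=\{x\in\mathcal A^{\mathbb Z}:\ \text{for every } k\ge 0,\ x[-k,k]\text{ is a subword of some word in }\mathcal G\}.$$ We say that $\mathcal G$ uniquely represents $X_{\rm seq}$ if for each $x\in X_{\rm seq}$ the sequence $(k_i)_{i\in\mathbb Z}$ above is unique up to enumeration. For $Y\subset \mathcal A^{\mathbb Z}$ let $\mathcal L_n(Y)$ be the set of words of length $n$ that occur in points of $Y$, and put $$h(Y)=\limsup_{n\to\infty}\frac{\log|\mathcal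 L_n(Y)|}{n},\qquad h_{\rm top}(X)=\lim_{n\to\infty}\frac{\log|\mathcal L_n(X)|}{n}=\inf_{n\ge1}\frac{\log|\mathcal L_n(X)|}{n}\qquad(\log 0=-\infty).$$ For a $\sigma$-invariant Borel probability measure $\mu$ on $X$ let $h_\sigma(\mu)=\lim_{n\to\infty}-\frac1n\sum_{w\in\mathcal L_n(X)}\mu([w])\log\mu([w])$, where $[w]=\{x: x[0,n)=w\}$ and terms with $\mu([w])=0$ are omitted. Let $h_{\rm seq}(X)$ (respectively $h_{\rm res}(X)$) be the supremum of $h_\sigma(\mu)$ over all $\sigma$-invariant Borel probability measures $\mu$ on $X$ with $\mu(X_{\rm seq})=1$ (respectively $\mu(X_{\rm res})=1$), where $\sup\emptyset=-\infty$. Suppose that $\mathcal G$ uniquely represents $X_{\rm seq}$ and that $h(X_{\rm lim})<h_{\rm top}(X)$. Then $$h_{\rm res}(X)\le h(X_{\rm lim})<h_{\rm seq}(X)=h_{\rm top}(X).$$ In particular, $h_{\rm res}(X)<h_{\rm seq}(X)$. -/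

import Mathlib

open Filter MeasureTheory
open scoped ENNReal

namespace CodedShift

variable {A : Type*}

/-- The left shift `σ` on the full shift `A^ℤ`. -/
def shift (x : ℤ → A) : ℤ → A := fun i => x (i + 1)

/-- The finite word `x[m, n) = x_m x_{m+1} … x_{n-1}` (for `m ≤ n`). -/
def block (x : ℤ → A) (m n : ℤ) : List A :=
  List.ofFn (fun j : Fin (n - m).toNat => x (m + (j : ℕ)))

/-- `k` cuts the point `x` into a bi-infinite concatenation of words of `G`: the integers `k i` are
strictly increasing and `x[k_i, k_{i+1}) ∈ G` for all `i`. -/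
def IsParsing (G : Set (List A)) (x : ℤ → A) (k : ℤ → ℤ) : Prop :=
  StrictMono k ∧ ∀ i : ℤ, block x (k i) (k (i + 1)) ∈ G

/-- The sequential set: all bi-infinite concatenations of generators. -/
def seqSet (G : Set (List A)) : Set (ℤ → A) := {x | ∃ k : ℤ → ℤ, IsParsing G x k}

/-- `G` uniquely represents its sequential set: any two ways of cutting a point into generators
have the same cut points, that is, they agree up to enumeration. -/
def UniquelyRepresents (G : Set (List A)) : Prop :=
  ∀ x ∈ seqSet G, ∀ k k' : ℤ → ℤ, IsParsing G x k → IsParsing G x k' →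
    Set.range k = Set.range k'

/-- The coded shift with generating set `G`: the closure of the sequential set in the product
topology. -/
def codedShift [TopologicalSpace A] (G : Set (List A)) : Set (ℤ → A) := closure (seqSet G)

/-- The residual set. -/
def resSet [TopologicalSpace A] (G : Set (List A)) : Set (ℤ → A) := codedShift G \ seqSet G

/-- The limit set: the points all of whose central words `x[-k, k]` are subwords of generators. -/
def limSet (G : Set (List A)) : Set (ℤ → A) :=
  {x | ∀ k : ℕ, ∃ g ∈ G, block x (-(k : ℤ)) ((k : ℤ) + 1) <:+: g}

/-- The words of length `n` that occur somewhere in a point of `Y`. -/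
def words (Y : Set (ℤ → A)) (n : ℕ) : Set (Fin n → A) :=
  {w | ∃ x ∈ Y, ∃ m : ℤ, ∀ j : Fin n, x (m + (j : ℕ)) = w j}

/-- `h(Y) = limsup (1/n) log |L_n(Y)|`, with `log 0 = -∞`. -/
noncomputable def wordEntropy (Y : Set (ℤ → A)) : EReal :=
  limsup (fun n : ℕ => ENNReal.log ((words Y n).encard : ℝ≥0∞) / (n : EReal)) atTop

/-- The topological entropy of a shift space `X`, i.e. the infimum over `n ≥ 1` of
`(1/n) log |L_n(X)|`, which for shift spaces is also the limit of this sequence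
(the sequence `log |L_n(X)|` being subadditive). -/
noncomputable def topEntropy (X : Set (ℤ → A)) : EReal :=
  ⨅ n : ℕ, ⨅ _ : 1 ≤ n, ENNReal.log ((words X n).encard : ℝ≥0∞) / (n : EReal)

/-- The cylinder `[w] = {x : x[0, n) = w}` of a word `w` of length `n`. -/
def cylinder {n : ℕ} (w : Fin n → A) : Set (ℤ → A) := {x | ∀ j : Fin n, x ((j : ℕ) : ℤ) = w j}

/-- The invariant Borel probability measures on the shift space `X`, as measures on `A^ℤ` that give
`X` full measure. For a finite discrete alphabet the product σ-algebra on `A^ℤ` is the Borel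
σ-algebra. -/
def invariantMeasures [MeasurableSpace A] (X : Set (ℤ → A)) : Set (Measure (ℤ → A)) :=
  {μ | IsProbabilityMeasure μ ∧ MeasurePreserving shift μ μ ∧ μ X = 1}

/-- The measure-theoretic entropy `h_σ(μ) = lim -(1/n) ∑_w μ[w] log μ[w]`, where `w` runs over the
words of length `n`. Words with `μ[w] = 0`, in particular those that do not occur in the shift
space carrying `μ`, contribute `0`. For invariant `μ` the limit exists and equals the `limsup`. -/
noncomputable def measureEntropy [Fintype A] [MeasurableSpace A] (μ : Measure (ℤ → A)) : EReal :=
  limsup (fun n : ℕ =>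
    (((1 / (n : ℝ)) * ∑ w : Fin n → A, Real.negMulLog (μ.real (cylinder w)) : ℝ) : EReal)) atTop

/-- The sequential entropy: the supremum (`-∞` if there is no such measure) of the entropies of the
invariant measures on the coded shift that give the sequential set full measure. -/
noncomputable def seqEntropy [Fintype A] [TopologicalSpace A] [MeasurableSpace A]
    (G : Set (List A)) : EReal :=
  ⨆ μ ∈ {μ | μ ∈ invariantMeasures (codedShift G) ∧ μ (seqSet G) = 1}, measureEntropy μ

/-- The residual entropy: the supremum (`-∞` if there is no such measure) of the entropies of the
invariant measures on the coded shift that give the residual set full measure. -/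
noncomputable def resEntropy [Fintype A] [TopologicalSpace A] [MeasurableSpace A]
    (G : Set (List A)) : EReal :=
  ⨆ μ ∈ {μ | μ ∈ invariantMeasures (codedShift G) ∧ μ (resSet G) = 1}, measureEntropy μ

end CodedShift

/-! The residual set is controlled by recurrence. Suppose that, for a point of the coded shift,
every ray to the right and every ray to the left contains a word that is not a subword of a
generator. Any parsing of a point agreeing with it there must cut inside that word, and a limit of
the cut sets of approximating sequential points parses the point itself. So a residual point has a
ray whose words are all subwords of generators (`resSet_subset`). The sets of points with such a ray
are nested and the shift permutes them. For an invariant measure their union and intersection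
therefore agree almost everywhere, and the intersection is the limit set
(`rightLim_or_leftLim_ae_limSet`). Consequently an invariant probability measure on the residual set
lives on the limit set, where counting words bounds its entropy. One that gives the limit set mass
zero lives on the sequential set.

For the sequential entropy, Misiurewicz's construction yields an invariant measure whose `q`-block
entropies are at least `q` times the topological entropy for every `q`
(`exists_invariantMeasure_entropy_ge`). The limit set is invariant with a strictly smaller growth
rate, so it cannot carry all of this measure, and conditioning on its complement keeps the entropy
maximal (`exists_invariant_complement_entropy_ge`). The conditioned measure lives on the sequential
set. The reverse inequality is word counting together with subadditivity. -/

namespace CodedShift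

/-! ### Shannon entropy of finite-valued functions. -/

section PartitionEntropy

variable {Ω : Type*} [MeasurableSpace Ω] {B C : Type*} [Fintype B] [Fintype C]

/-- The Gibbs inequality for a single term. -/
theorem negMulLog_le_gibbs {p q : ℝ} (hp : 0 ≤ p) (hq : 0 < q) :
    Real.negMulLog p ≤ -(p * Real.log q) + q - p := by
  rcases hp.eq_or_lt with rfl | hp
  · simpa using hq.le
  · have h := Real.log_le_sub_one_of_pos (div_pos hq hp)
    rw [Real.log_div hq.ne' hp.ne'] at h
    have h2 := mul_le_mul_of_nonneg_left h hp.le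
    have h3 : p * (q / p - 1) = q - p := by field_simp
    rw [h3] at h2
    unfold Real.negMulLog
    linarith

theorem negMulLog_add_le {x y : ℝ} (hx : 0 ≤ x) (hy : 0 ≤ y) :
    Real.negMulLog (x + y) ≤ Real.negMulLog x + Real.negMulLog y := by
  rcases hx.eq_or_lt with rfl | hx
  · simp
  rcases hy.eq_or_lt with rfl | hy
  · simp
  have h1 : Real.log x ≤ Real.log (x + y) := Real.log_le_log hx (by linarith)
  have h2 : Real.log y ≤ Real.log (x + y) := Real.log_le_log hy (by linarith)
  unfold Real.negMulLog
  nlinarith [mul_le_mul_of_nonneg_left h1 hx.le, mul_le_mul_of_nonneg_left h2 hy.le]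

/-- A family of nonnegative numbers of total mass `a` supported on a finite set `s` has entropy at
most that of the uniform distribution on `s`. -/
theorem sum_negMulLog_le {p : B → ℝ} (hp : ∀ b, 0 ≤ p b) (s : Finset B)
    (hs : ∀ b, b ∉ s → p b = 0) :
    ∑ b, Real.negMulLog (p b) ≤
      (∑ b, p b) * Real.log s.card + Real.negMulLog (∑ b, p b) := by
  set a := ∑ b, p b with ha
  rcases (Finset.sum_nonneg fun b _ => hp b : 0 ≤ a).eq_or_lt with h0 | h0
  · have : ∀ b, p b = 0 := fun b =>
      (Finset.sum_eq_zero_iff_of_nonneg fun b _ => hp b).1 h0.symm b (Finset.mem_univ b)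
    have h0' : a = 0 := h0.symm
    simp [this, h0']
  have hsub : ∀ f : B → ℝ, (∀ b, p b = 0 → f b = 0) → ∑ b, f b = ∑ b ∈ s, f b := fun f hf =>
    (Finset.sum_subset (Finset.subset_univ s) fun b _ hb => hf b (hs b hb)).symm
  have has : a = ∑ b ∈ s, p b := hsub _ fun _ h => h
  have hcard : 0 < (s.card : ℝ) := by
    rw [Nat.cast_pos, Finset.card_pos, Finset.nonempty_iff_ne_empty]
    rintro rfl
    rw [← ha, has, Finset.sum_empty] at h0
    exact h0.false
  rw [hsub _ fun b h => by simp [h]]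
  -- Gibbs against the uniform weights `a / s.card`; the corrections `a / s.card - p b` sum to zero.
  calc ∑ b ∈ s, Real.negMulLog (p b)
      ≤ ∑ b ∈ s, (-(p b * Real.log (a / s.card)) + a / s.card - p b) :=
        Finset.sum_le_sum fun b _ => negMulLog_le_gibbs (hp b) (div_pos h0 hcard)
    _ = -(a * Real.log (a / s.card)) := by
        rw [Finset.sum_sub_distrib, Finset.sum_add_distrib, Finset.sum_neg_distrib,
          ← Finset.sum_mul, ← has, Finset.sum_const, nsmul_eq_mul]
        field_simp
        ring
    _ = _ := by
        rw [Real.log_div h0.ne' hcard.ne', Real.negMulLog]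
        ring

/-- The Shannon entropy of a function with finitely many values. -/
noncomputable def entropyOf (μ : Measure Ω) (f : Ω → B) : ℝ :=
  ∑ b, Real.negMulLog (μ.real (f ⁻¹' {b}))

theorem sum_real_preimage (μ : Measure Ω) [IsFiniteMeasure μ] {f : Ω → B}
    (hf : ∀ b, MeasurableSet (f ⁻¹' {b})) : ∑ b, μ.real (f ⁻¹' {b}) = μ.real Set.univ := by
  rw [sum_measureReal_preimage_singleton _ fun b _ => hf b]
  simp

theorem entropyOf_le_log_card (μ : Measure Ω) [IsProbabilityMeasure μ] {f : Ω → B}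
    (hf : ∀ b, MeasurableSet (f ⁻¹' {b})) (s : Finset B) (hs : ∀ b, b ∉ s → μ (f ⁻¹' {b}) = 0) :
    entropyOf μ f ≤ Real.log s.card := by
  have h := sum_negMulLog_le (p := fun b => μ.real (f ⁻¹' {b})) (fun b => measureReal_nonneg) s
    (fun b hb => by simp [Measure.real, hs b hb])
  simpa [sum_real_preimage μ hf, entropyOf] using h

theorem entropyOf_comp_injective (μ : Measure Ω) (f : Ω → B) {e : B → C}
    (he : Function.Injective e) : entropyOf μ (fun x => e (f x)) = entropyOf μ f := by
  classical
  unfold entropyOf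
  rw [← Finset.sum_subset (Finset.subset_univ (Finset.univ.image e)),
    Finset.sum_image fun _ _ _ _ h => he h]
  · refine Finset.sum_congr rfl fun b _ => ?_
    congr 2
    ext x
    simp [he.eq_iff]
  · intro c _ hc
    have : (fun x => e (f x)) ⁻¹' {c} = ∅ := by
      ext x
      simp only [Set.mem_preimage, Set.mem_singleton_iff, Set.mem_empty_iff_false, iff_false]
      rintro rfl
      exact hc (by simp)
    simp [this]

/-- This is Gibbs' inequality for the joint distribution against the product of its marginals. -/
theorem entropyOf_prod_le (μ : Measure Ω) [IsProbabilityMeasure μ] {f : Ω → B} {g : Ω → C}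
    (hf : ∀ b, MeasurableSet (f ⁻¹' {b})) (hg : ∀ c, MeasurableSet (g ⁻¹' {c})) :
    entropyOf μ (fun x => (f x, g x)) ≤ entropyOf μ f + entropyOf μ g := by
  have hpre : ∀ b c, (fun x => (f x, g x)) ⁻¹' {(b, c)} = f ⁻¹' {b} ∩ g ⁻¹' {c} := by
    intro b c
    ext x
    simp
  set p : B → C → ℝ := fun b c => μ.real (f ⁻¹' {b} ∩ g ⁻¹' {c}) with hp
  set p₁ : B → ℝ := fun b => μ.real (f ⁻¹' {b}) with hp₁
  set p₂ : C → ℝ := fun c => μ.real (g ⁻¹' {c}) with hp₂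
  have m₁ : ∀ b, ∑ c, p b c = p₁ b := by
    intro b
    have := sum_real_preimage (μ.restrict (f ⁻¹' {b})) hg
    simp only [measureReal_restrict_apply (hg _), MeasurableSet.univ, measureReal_restrict_apply,
      Set.univ_inter] at this
    simpa [hp, hp₁, Set.inter_comm] using this
  have m₂ : ∀ c, ∑ b, p b c = p₂ c := by
    intro c
    have := sum_real_preimage (μ.restrict (g ⁻¹' {c})) hf
    simpa only [measureReal_restrict_apply (hf _), MeasurableSet.univ, measureReal_restrict_apply,
      Set.univ_inter] using this
  have t₁ : ∑ b, p₁ b = 1 := by simpa using sum_real_preimage μ hf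
  have t₂ : ∑ c, p₂ c = 1 := by simpa using sum_real_preimage μ hg
  have term : ∀ b c, Real.negMulLog (p b c) ≤
      -(p b c * Real.log (p₁ b)) - p b c * Real.log (p₂ c) + p₁ b * p₂ c - p b c := by
    intro b c
    have h0 : 0 ≤ p b c := measureReal_nonneg
    have h1 : p b c ≤ p₁ b := measureReal_mono Set.inter_subset_left
    have h2 : p b c ≤ p₂ c := measureReal_mono Set.inter_subset_right
    -- When the joint mass vanishes a marginal may vanish too, so the logarithm of the product
    -- cannot be split.
    rcases h0.eq_or_lt with h | h
    · rw [← h] at h1 h2 ⊢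
      simpa using mul_nonneg h1 h2
    · have := negMulLog_le_gibbs h0 (mul_pos (h.trans_le h1) (h.trans_le h2))
      rw [Real.log_mul (h.trans_le h1).ne' (h.trans_le h2).ne'] at this
      linarith
  unfold entropyOf
  rw [Fintype.sum_prod_type]
  simp only [hpre]
  calc ∑ b, ∑ c, Real.negMulLog (p b c)
      ≤ ∑ b, ∑ c, (-(p b c * Real.log (p₁ b)) - p b c * Real.log (p₂ c) + p₁ b * p₂ c - p b c) :=
        Finset.sum_le_sum fun b _ => Finset.sum_le_sum fun c _ => term b c
    _ = -(∑ b, ∑ c, p b c * Real.log (p₁ b)) - (∑ c, ∑ b, p b c * Real.log (p₂ c))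
          + ∑ b, ∑ c, p₁ b * p₂ c - ∑ b, ∑ c, p b c := by
        rw [Finset.sum_comm (f := fun c b => p b c * Real.log (p₂ c))]
        simp only [Finset.sum_sub_distrib, Finset.sum_add_distrib, Finset.sum_neg_distrib]
    _ = _ := by
        simp only [← Finset.sum_mul, m₁, m₂, ← Finset.mul_sum, t₁, t₂, Real.negMulLog]
        simp only [neg_mul, Finset.sum_neg_distrib, hp₁, hp₂]
        ring

/-- Subadditivity of `-t log t` lets the two restrictions stay unnormalized; this later separates
the limit set from its complement. -/
theorem entropyOf_le_inter_add_inter (μ : Measure Ω) [IsFiniteMeasure μ] {f : Ω → B}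
    {s : Set Ω} (hs : MeasurableSet s) :
    entropyOf μ f ≤ entropyOf (μ.restrict s) f + entropyOf (μ.restrict sᶜ) f := by
  unfold entropyOf
  rw [← Finset.sum_add_distrib]
  refine Finset.sum_le_sum fun b _ => ?_
  rw [measureReal_restrict_apply' hs, measureReal_restrict_apply' hs.compl,
    ← measureReal_inter_add_sdiff (μ := μ) hs, Set.sdiff_eq]
  exact negMulLog_add_le measureReal_nonneg measureReal_nonneg

/-- The entropy of the distribution `μ / r`, where `r` is the mass of `μ`. -/
theorem entropyOf_eq_mul_smul (μ : Measure Ω) [IsFiniteMeasure μ] {f : Ω → B}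
    (hf : ∀ b, MeasurableSet (f ⁻¹' {b})) (h : μ Set.univ ≠ 0) :
    entropyOf μ f = μ.real Set.univ * entropyOf ((μ Set.univ)⁻¹ • μ) f
      + Real.negMulLog (μ.real Set.univ) := by
  set r := μ.real Set.univ with hr
  have hr0 : r ≠ 0 := by simpa [hr, measureReal_eq_zero_iff] using h
  have key : ∀ b, Real.negMulLog (μ.real (f ⁻¹' {b})) =
      r * Real.negMulLog (((μ Set.univ)⁻¹ • μ).real (f ⁻¹' {b})) +
        μ.real (f ⁻¹' {b}) * (-Real.log r) := by
    intro b
    have h1 : μ.real (f ⁻¹' {b}) = ((μ Set.univ)⁻¹ • μ).real (f ⁻¹' {b}) * r := by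
      rw [measureReal_ennreal_smul_apply, ENNReal.toReal_inv]
      change _ = r⁻¹ * _ * r
      field_simp
    generalize ((μ Set.univ)⁻¹ • μ).real (f ⁻¹' {b}) = y at h1 ⊢
    rw [h1, Real.negMulLog_mul, Real.negMulLog, Real.negMulLog]
    ring
  unfold entropyOf
  rw [Finset.sum_congr rfl fun b _ => key b, Finset.sum_add_distrib, ← Finset.mul_sum,
    ← Finset.sum_mul, sum_real_preimage μ hf, Real.negMulLog]
  ring

/-- The average of a finite family of measures. -/
noncomputable def avgMeasure {ι : Type*} (s : Finset ι) (ν : ι → Measure Ω) : Measure Ω :=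
  (s.card : ℝ≥0∞)⁻¹ • ∑ i ∈ s, ν i

section Average

variable {ι : Type*} {s : Finset ι} {ν : ι → Measure Ω}

theorem avgMeasure_apply (E : Set Ω) :
    avgMeasure s ν E = (s.card : ℝ≥0∞)⁻¹ * ∑ i ∈ s, ν i E := by
  simp [avgMeasure, Measure.finsetSum_apply]

theorem avgMeasure_eq_one (hs : s.Nonempty) {E : Set Ω} (h : ∀ i ∈ s, ν i E = 1) :
    avgMeasure s ν E = 1 := by
  rw [avgMeasure_apply, Finset.sum_congr rfl h, Finset.sum_const, nsmul_eq_mul, mul_one]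
  exact ENNReal.inv_mul_cancel (by simpa using hs.ne_empty) (ENNReal.natCast_ne_top _)

theorem avgMeasure_isProbabilityMeasure (hs : s.Nonempty) [∀ i, IsProbabilityMeasure (ν i)] :
    IsProbabilityMeasure (avgMeasure s ν) :=
  ⟨avgMeasure_eq_one hs fun _ _ => measure_univ⟩

theorem avgMeasure_real [∀ i, IsFiniteMeasure (ν i)] (E : Set Ω) :
    (avgMeasure s ν).real E = (s.card : ℝ)⁻¹ * ∑ i ∈ s, (ν i).real E := by
  rw [Measure.real, avgMeasure_apply, ENNReal.toReal_mul,
    ENNReal.toReal_sum fun i _ => measure_ne_top _ _]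
  simp [Measure.real]

/-- Jensen's inequality with equal weights for the concave function `-t log t`. -/
theorem sum_entropyOf_le_avgMeasure (hs : s.Nonempty) [∀ i, IsFiniteMeasure (ν i)] (f : Ω → B) :
    ∑ i ∈ s, entropyOf (ν i) f ≤ s.card * entropyOf (avgMeasure s ν) f := by
  have hc : (s.card : ℝ) ≠ 0 := by simpa using hs.ne_empty
  unfold entropyOf
  rw [Finset.sum_comm, Finset.mul_sum]
  refine Finset.sum_le_sum fun b _ => ?_
  have := Real.concaveOn_negMulLog.le_map_sum (t := s) (w := fun _ => (s.card : ℝ)⁻¹)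
    (p := fun i => (ν i).real (f ⁻¹' {b})) (fun _ _ => by positivity) (by simp [hc])
    (fun _ _ => measureReal_nonneg)
  simp only [smul_eq_mul, ← Finset.mul_sum] at this
  rw [avgMeasure_real]
  calc _ = (s.card : ℝ) * ((s.card : ℝ)⁻¹ * ∑ i ∈ s, Real.negMulLog ((ν i).real (f ⁻¹' {b}))) := by
        field_simp
    _ ≤ _ := by gcongr

end Average

/-- A function separating the points `z i` has entropy `log |ι|` for the uniform distribution on
these points. -/
theorem entropyOf_uniform {ι : Type*} [Fintype ι] [Nonempty ι] (z : ι → Ω) {f : Ω → B}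
    (hf : ∀ b, MeasurableSet (f ⁻¹' {b})) (hz : Function.Injective fun i => f (z i)) :
    entropyOf (avgMeasure Finset.univ fun i => Measure.dirac (z i)) f =
      Real.log (Fintype.card ι) := by
  classical
  have hc : (Fintype.card ι : ℝ) ≠ 0 := by simp
  unfold entropyOf
  rw [← Finset.sum_subset (Finset.subset_univ (Finset.univ.image fun i => f (z i))),
    Finset.sum_image fun _ _ _ _ h => hz h]
  · have : ∀ i, (avgMeasure Finset.univ fun i => Measure.dirac (z i)).real (f ⁻¹' {f (z i)}) =
        (Fintype.card ι : ℝ)⁻¹ := by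
      intro i
      rw [avgMeasure_real, Finset.sum_eq_single i]
      · simp [Measure.real, Measure.dirac_apply' _ (hf _)]
      · intro j _ hj
        have : f (z j) ≠ f (z i) := fun h => hj (hz h)
        simp [Measure.real, Measure.dirac_apply' _ (hf _), this]
      · simp
    simp only [this, Finset.sum_const, Finset.card_univ, nsmul_eq_mul, Real.negMulLog,
      Real.log_inv]
    field_simp
  · intro b _ hb
    have : ∀ i, f (z i) ≠ b := fun i h => hb (by simp [← h])
    rw [avgMeasure_real]
    simp [Measure.real, Measure.dirac_apply' _ (hf _), this]

end PartitionEntropy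

/-! ### Subwords of generators, rays and the limit set. -/

section Words

variable {A : Type*}

theorem block_length (x : ℤ → A) (a b : ℤ) : (block x a b).length = (b - a).toNat := by
  simp [block]

theorem block_getElem (x : ℤ → A) (a b : ℤ) (i : ℕ) (h : i < (block x a b).length) :
    (block x a b)[i] = x (a + i) := by
  simp [block]

theorem block_append (x : ℤ → A) {a b c : ℤ} (hab : a ≤ b) (hbc : b ≤ c) :
    block x a b ++ block x b c = block x a c := by
  apply List.ext_getElem
  · simp only [List.length_append, block_length]
    omega
  · intro i h₁ h₂
    rw [List.getElem_append]
    split_ifs with h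
    · rw [block_getElem, block_getElem]
    · rw [block_getElem, block_getElem]
      rw [block_length] at h ⊢
      congr 1
      omega

theorem block_infix (x : ℤ → A) {a b a' b' : ℤ} (h₁ : a ≤ a') (h₂ : a' ≤ b') (h₃ : b' ≤ b) :
    block x a' b' <:+: block x a b := by
  rw [← block_append x (h₁.trans h₂) h₃, ← block_append x h₁ h₂]
  exact ⟨_, _, rfl⟩

theorem block_congr {x y : ℤ → A} {a b : ℤ} (h : ∀ i, a ≤ i → i < b → x i = y i) :
    block x a b = block y a b := by
  apply List.ext_getElem
  · simp only [block_length]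
  · intro i h₁ h₂
    rw [block_getElem, block_getElem]
    rw [block_length] at h₁
    exact h _ (by omega) (by omega)

/-- The `m`-th power of the shift, for an integer `m`. -/
def translate (m : ℤ) (x : ℤ → A) : ℤ → A := fun i => x (i + m)

theorem block_translate (m : ℤ) (x : ℤ → A) (a b : ℤ) :
    block (translate m x) a b = block x (a + m) (b + m) := by
  apply List.ext_getElem
  · simp only [block_length]
    omega
  · intro i h₁ h₂
    rw [block_getElem, block_getElem, translate]
    congr 1
    ring

theorem block_shift (x : ℤ → A) (a b : ℤ) : block (shift x) a b = block x (a + 1) (b + 1) :=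
  block_translate 1 x a b

/-- The word `x[a, b)` is a subword of a generator. -/
def IsSubword (G : Set (List A)) (x : ℤ → A) (a b : ℤ) : Prop := ∃ g ∈ G, block x a b <:+: g

theorem IsSubword.mono {G : Set (List A)} {x : ℤ → A} {a b a' b' : ℤ} (h : IsSubword G x a b)
    (h₁ : a ≤ a') (h₂ : a' ≤ b') (h₃ : b' ≤ b) : IsSubword G x a' b' :=
  let ⟨g, hg, h⟩ := h
  ⟨g, hg, (block_infix x h₁ h₂ h₃).trans h⟩

theorem isSubword_congr {G : Set (List A)} {x y : ℤ → A} {a b : ℤ}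
    (h : ∀ i, a ≤ i → i < b → x i = y i) : IsSubword G x a b ↔ IsSubword G y a b := by
  rw [IsSubword, IsSubword, block_congr h]

theorem isSubword_shift {G : Set (List A)} {x : ℤ → A} {a b : ℤ} :
    IsSubword G (shift x) a b ↔ IsSubword G x (a + 1) (b + 1) := by
  rw [IsSubword, IsSubword, block_shift]

theorem mem_limSet_iff {G : Set (List A)} {x : ℤ → A} :
    x ∈ limSet G ↔ ∀ a b, a ≤ b → IsSubword G x a b := by
  refine ⟨fun h a b hab => ?_, fun h k => h _ _ (by omega)⟩
  have hk : IsSubword G x (-((a.natAbs + b.natAbs : ℕ) : ℤ)) ((a.natAbs + b.natAbs : ℕ) + 1) :=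
    h (a.natAbs + b.natAbs)
  exact hk.mono (by omega) hab (by omega)

/-- The points all of whose words starting at `k` are subwords of generators. -/
def rightLim (G : Set (List A)) (k : ℤ) : Set (ℤ → A) := {x | ∀ n : ℕ, IsSubword G x k (k + n)}

/-- The points all of whose words ending at `k` are subwords of generators. -/
def leftLim (G : Set (List A)) (k : ℤ) : Set (ℤ → A) := {x | ∀ n : ℕ, IsSubword G x (k - n) k}

theorem rightLim_subset_succ (G : Set (List A)) (k : ℤ) : rightLim G k ⊆ rightLim G (k + 1) :=
  fun _ hx n => (hx (n + 1)).mono (by omega) (by omega) (by push_cast; omega)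

theorem leftLim_succ_subset (G : Set (List A)) (k : ℤ) : leftLim G (k + 1) ⊆ leftLim G k :=
  fun _ hx n => (hx (n + 1)).mono (by push_cast; omega) (by omega) (by omega)

theorem shift_preimage_rightLim (G : Set (List A)) (k : ℤ) :
    shift ⁻¹' rightLim G k = rightLim G (k + 1) := by
  ext x
  simp only [rightLim, Set.mem_preimage, Set.mem_ofPred_eq, isSubword_shift, add_right_comm]

theorem shift_preimage_leftLim (G : Set (List A)) (k : ℤ) :
    shift ⁻¹' leftLim G k = leftLim G (k + 1) := by
  ext x
  simp only [leftLim, Set.mem_preimage, Set.mem_ofPred_eq, isSubword_shift, sub_add_eq_add_sub]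

theorem limSet_eq_iInter_rightLim (G : Set (List A)) : limSet G = ⋂ k, rightLim G k := by
  ext x
  simp only [mem_limSet_iff, Set.mem_iInter]
  refine ⟨fun h k n => h _ _ (by omega), fun h a b hab => ?_⟩
  have := h a (b - a).toNat
  rwa [show a + ((b - a).toNat : ℤ) = b by omega] at this

theorem limSet_eq_iInter_leftLim (G : Set (List A)) : limSet G = ⋂ k, leftLim G k := by
  ext x
  simp only [mem_limSet_iff, Set.mem_iInter]
  refine ⟨fun h k n => h _ _ (by omega), fun h a b hab => ?_⟩
  have := h b (b - a).toNat
  rwa [show b - ((b - a).toNat : ℤ) = a by omega] at this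

theorem shift_preimage_limSet (G : Set (List A)) : shift ⁻¹' limSet G = limSet G := by
  rw [limSet_eq_iInter_rightLim, Set.preimage_iInter]
  simp only [shift_preimage_rightLim]
  exact (Equiv.addRight (1 : ℤ)).surjective.iInter_comp (rightLim G)

end Words

/-! ### Cut points and the structure of residual points. -/

section Parsing

variable {A : Type*}

theorem exists_le_lt_of_strictMono {k : ℤ → ℤ} (hk : StrictMono k) (a : ℤ) :
    ∃ i, k i ≤ a ∧ a < k (i + 1) := by
  have hup : ∀ n : ℕ, k 0 + n ≤ k n := by
    intro n
    induction n with
    | zero => simp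
    | succ n ih =>
      have := hk (show (n : ℤ) < (n + 1 : ℕ) by omega)
      push_cast at this ⊢
      omega
  have hdn : ∀ n : ℕ, k (-n) ≤ k 0 - n := by
    intro n
    induction n with
    | zero => simp
    | succ n ih =>
      have := hk (show (-((n + 1 : ℕ) : ℤ)) < -(n : ℤ) by omega)
      push_cast at this ⊢
      omega
  obtain ⟨i, hi, hmax⟩ := Int.exists_greatest_of_bdd (P := fun i => k i ≤ a)
    ⟨(a - k 0).toNat, fun z hz => by
      by_contra hlt
      have h1 := hk (not_le.1 hlt)
      have h2 := hup (a - k 0).toNat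
      omega⟩
    ⟨-(k 0 - a).toNat, by
      have := hdn (k 0 - a).toNat
      omega⟩
  refine ⟨i, hi, ?_⟩
  by_contra h
  have := hmax (i + 1) (not_lt.1 h)
  omega

/-- Without a cut strictly inside, the whole word would lie in a single generator block. -/
theorem IsParsing.exists_cut {G : Set (List A)} {x : ℤ → A} {k : ℤ → ℤ} (hk : IsParsing G x k)
    {a b : ℤ} (hab : a ≤ b) (h : ¬ IsSubword G x a b) : ∃ c ∈ Set.Ioo a b, c ∈ Set.range k := by
  obtain ⟨i, h₁, h₂⟩ := exists_le_lt_of_strictMono hk.1 a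
  refine ⟨k (i + 1), ⟨h₂, ?_⟩, i + 1, rfl⟩
  by_contra h₃
  exact h ⟨_, hk.2 i, block_infix x h₁ hab (not_lt.1 h₃)⟩

theorem IsParsing.block_mem {G : Set (List A)} {x : ℤ → A} {k : ℤ → ℤ} (hk : IsParsing G x k)
    {c d : ℤ} (hc : c ∈ Set.range k) (hd : d ∈ Set.range k) (hcd : c < d)
    (h : ∀ e ∈ Set.Ioo c d, e ∉ Set.range k) : block x c d ∈ G := by
  obtain ⟨i, rfl⟩ := hc
  obtain ⟨j, rfl⟩ := hd
  have hij : i < j := hk.1.lt_iff_lt.1 hcd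
  have h1 : k (i + 1) ≤ k j := hk.1.monotone (by omega)
  have h2 : k i < k (i + 1) := hk.1 (by omega)
  have h3 : k (i + 1) = k j := by
    by_contra hne
    exact h _ ⟨h2, lt_of_le_of_ne h1 hne⟩ ⟨_, rfl⟩
  rw [← h3]
  exact hk.2 i

/-- A set of cut points that is unbounded on both sides can be enumerated by a parsing. -/
theorem mem_seqSet_of_cuts {G : Set (List A)} {x : ℤ → A} (C : Set ℤ)
    (hup : ∀ a, ∃ c ∈ C, a < c) (hdn : ∀ a, ∃ c ∈ C, c < a)
    (hC : ∀ c ∈ C, ∀ d ∈ C, c < d → (∀ e ∈ Set.Ioo c d, e ∉ C) → block x c d ∈ G) :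
    x ∈ seqSet G := by
  classical
  -- A nonempty set of integers unbounded on both sides is order isomorphic to `ℤ`.
  let _ : SuccOrder C := LinearLocallyFiniteOrder.succOrder C
  let _ : PredOrder C := LinearLocallyFiniteOrder.predOrder C
  have : NoMaxOrder C := ⟨fun a => let ⟨c, hc, h⟩ := hup a; ⟨⟨c, hc⟩, h⟩⟩
  have : NoMinOrder C := ⟨fun a => let ⟨c, hc, h⟩ := hdn a; ⟨⟨c, hc⟩, h⟩⟩
  have : Nonempty C := let ⟨c, hc, _⟩ := hup 0; ⟨⟨c, hc⟩⟩
  let e : ℤ ≃o C := (orderIsoIntOfLinearSuccPredArch (ι := C)).symm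
  refine ⟨fun i => (e i : ℤ), fun i j hij => e.strictMono hij, fun i => ?_⟩
  refine hC _ (e i).2 _ (e (i + 1)).2 (e.strictMono (by omega)) fun c hc hcC => ?_
  obtain ⟨j, hj⟩ := e.surjective ⟨c, hcC⟩
  have hjc : (e j : ℤ) = c := by rw [hj]
  rw [← hjc] at hc
  have h1 : i < j := e.lt_iff_lt.1 hc.1
  have h2 : j < i + 1 := e.lt_iff_lt.1 hc.2
  omega

theorem exists_seqSet_agree [TopologicalSpace A] [DiscreteTopology A] {G : Set (List A)}
    {x : ℤ → A} (hx : x ∈ codedShift G) (N : ℕ) :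
    ∃ y ∈ seqSet G, ∀ i : ℤ, -N ≤ i → i ≤ N → y i = x i := by
  have hopen : IsOpen ((Set.Icc (-(N : ℤ)) N).pi fun i => {x i}) :=
    isOpen_set_pi (Set.finite_Icc _ _) fun i _ => isOpen_discrete _
  obtain ⟨y, hy, hyG⟩ := mem_closure_iff.1 hx _ hopen fun i _ => rfl
  exact ⟨y, hyG, fun i h₁ h₂ => hy i ⟨h₁, h₂⟩⟩

/-- Parsings of sequential points approximating `x` have an ultrafilter limit as cut sets. Each word
of `x` that is not a subword of a generator forces a cut in a bounded interval, so cuts cannot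
escape to infinity. -/
theorem mem_seqSet_of_not_mem_lim [TopologicalSpace A] [DiscreteTopology A] {G : Set (List A)}
    {x : ℤ → A} (hx : x ∈ codedShift G) (hr : ∀ k, x ∉ rightLim G k)
    (hl : ∀ k, x ∉ leftLim G k) : x ∈ seqSet G := by
  choose y hy hyx using exists_seqSet_agree hx
  choose κ hκ using hy
  let U : Ultrafilter ℕ := hyperfilter ℕ
  have hagree : ∀ a b : ℤ, ∀ᶠ N in (U : Filter ℕ), ∀ i, a ≤ i → i < b → y N i = x i := by
    intro a b
    refine (Nat.hyperfilter_le_atTop : (U : Filter ℕ) ≤ atTop) ?_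
    filter_upwards [eventually_ge_atTop (a.natAbs + b.natAbs)] with N hN i h₁ h₂
    exact hyx N i (by omega) (by omega)
  let C : Set ℤ := {c | ∀ᶠ N in (U : Filter ℕ), c ∈ Set.range (κ N)}
  have hcut : ∀ a b : ℤ, a ≤ b → ¬ IsSubword G x a b → ∃ c ∈ Set.Ioo a b, c ∈ C := by
    intro a b hab h
    -- The cut may depend on `N`, but only finitely many positions are available, so the ultrafilter
    -- selects one.
    refine (Ultrafilter.eventually_exists_mem_iff (Set.finite_Ioo a b)).1 ?_
    filter_upwards [hagree a b] with N hN
    exact (hκ N).exists_cut hab (by rwa [isSubword_congr hN])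
  refine mem_seqSet_of_cuts C (fun a => ?_) (fun a => ?_) fun c hc d hd hcd hgap => ?_
  · have := hr a
    simp only [rightLim, Set.mem_ofPred_eq, not_forall] at this
    obtain ⟨n, hn⟩ := this
    obtain ⟨c, hc, hcC⟩ := hcut _ _ (by omega) hn
    exact ⟨c, hcC, hc.1⟩
  · have := hl a
    simp only [leftLim, Set.mem_ofPred_eq, not_forall] at this
    obtain ⟨n, hn⟩ := this
    obtain ⟨c, hc, hcC⟩ := hcut _ _ (by omega) hn
    exact ⟨c, hcC, hc.2⟩
  -- A position outside `C` is not a cut for almost all `N`; finitely many such conditions hold at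
  -- once, so one `N` has `c` and `d` as consecutive cuts.
  · have hgap' : ∀ᶠ N in (U : Filter ℕ), ∀ e ∈ Set.Ioo c d, e ∉ Set.range (κ N) :=
      (eventually_all_finite (Set.finite_Ioo c d)).2 fun e he =>
        Ultrafilter.eventually_not.2 (hgap e he)
    obtain ⟨N, h₁, h₂, h₃, h₄⟩ :=
      (hc.and (hd.and (hgap'.and (hagree c d)))).exists
    rw [← block_congr h₄]
    exact (hκ N).block_mem h₁ h₂ hcd h₃

theorem resSet_subset [TopologicalSpace A] [DiscreteTopology A] (G : Set (List A)) :
    resSet G ⊆ (⋃ k, rightLim G k) ∪ ⋃ k, leftLim G k := by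
  rintro x ⟨hx, hs⟩
  by_contra h
  simp only [Set.mem_union, Set.mem_iUnion, not_or, not_exists] at h
  exact hs (mem_seqSet_of_not_mem_lim hx h.1 h.2)

end Parsing

/-! ### Windows, translations and measurability. -/

section Window

variable {A : Type*}

/-- The word of length `n` of `x` at position `m`, as a function. -/
def window (m : ℤ) (n : ℕ) (x : ℤ → A) : Fin n → A := fun j => x (m + (j : ℕ))

theorem cylinder_eq_preimage {n : ℕ} (w : Fin n → A) : cylinder w = window 0 n ⁻¹' {w} := by
  ext x
  simp [cylinder, window, funext_iff]

theorem window_mem_words {Y : Set (ℤ → A)} {x : ℤ → A} (hx : x ∈ Y) (m : ℤ) (n : ℕ) :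
    window m n x ∈ words Y n := ⟨x, hx, m, fun _ => rfl⟩

theorem window_translate (m k : ℤ) (n : ℕ) (x : ℤ → A) :
    window m n (translate k x) = window (m + k) n x := by
  funext j
  simp only [window, translate]
  congr 1
  ring

theorem translate_mem_seqSet {G : Set (List A)} {x : ℤ → A} (hx : x ∈ seqSet G) (m : ℤ) :
    translate m x ∈ seqSet G := by
  obtain ⟨k, hk, h⟩ := hx
  refine ⟨fun i => k i - m, fun i j hij => sub_lt_sub_right (hk hij) m, fun i => ?_⟩
  rw [block_translate]
  simpa using h i

theorem continuous_translate [TopologicalSpace A] (m : ℤ) :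
    Continuous (translate m : (ℤ → A) → ℤ → A) :=
  continuous_pi fun i => continuous_apply (i + m)

theorem continuous_shift [TopologicalSpace A] : Continuous (shift : (ℤ → A) → ℤ → A) :=
  continuous_translate 1

theorem translate_mem_codedShift [TopologicalSpace A] {G : Set (List A)} {x : ℤ → A}
    (hx : x ∈ codedShift G) (m : ℤ) : translate m x ∈ codedShift G :=
  map_mem_closure (continuous_translate m) hx fun _ hy => translate_mem_seqSet hy m

theorem continuous_window [TopologicalSpace A] (m : ℤ) (n : ℕ) :
    Continuous (window m n : (ℤ → A) → Fin n → A) :=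
  continuous_pi fun j => continuous_apply (m + (j : ℕ))

variable [MeasurableSpace A]

theorem measurable_translate (m : ℤ) : Measurable (translate m : (ℤ → A) → ℤ → A) :=
  measurable_pi_lambda _ fun i => measurable_pi_apply (i + m)

theorem measurable_shift : Measurable (shift : (ℤ → A) → ℤ → A) := measurable_translate 1

theorem measurable_window (m : ℤ) (n : ℕ) : Measurable (window m n : (ℤ → A) → Fin n → A) :=
  measurable_pi_lambda _ fun j => measurable_pi_apply (m + (j : ℕ))

variable [Fintype A] [DiscreteMeasurableSpace A]

theorem measurableSet_window_preimage (m : ℤ) (n : ℕ) (E : Set (Fin n → A)) :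
    MeasurableSet (window m n ⁻¹' E) := measurable_window m n .of_discrete

theorem measurableSet_isSubword (G : Set (List A)) (a b : ℤ) :
    MeasurableSet {x | IsSubword G x a b} :=
  -- By definition `block` is `List.ofFn` of a window, so the set is a window preimage up to
  -- unfolding.
  measurableSet_window_preimage a (b - a).toNat {w | ∃ g ∈ G, List.ofFn w <:+: g}

theorem measurableSet_rightLim (G : Set (List A)) (k : ℤ) : MeasurableSet (rightLim G k) := by
  have : rightLim G k = ⋂ n : ℕ, {x | IsSubword G x k (k + n)} := by
    ext x
    simp [rightLim]
  rw [this]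
  exact .iInter fun n => measurableSet_isSubword G _ _

theorem measurableSet_leftLim (G : Set (List A)) (k : ℤ) : MeasurableSet (leftLim G k) := by
  have : leftLim G k = ⋂ n : ℕ, {x | IsSubword G x (k - n) k} := by
    ext x
    simp [leftLim]
  rw [this]
  exact .iInter fun n => measurableSet_isSubword G _ _

theorem measurableSet_limSet (G : Set (List A)) : MeasurableSet (limSet G) := by
  rw [limSet_eq_iInter_rightLim]
  exact .iInter fun k => measurableSet_rightLim G k

end Window

/-! ### Invariant measures on the residual and sequential sets. -/

section Recurrence

variable {A : Type*} [MeasurableSpace A]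

/-- If consecutive sets of a family agree almost everywhere, then the union of the family agrees
almost everywhere with its intersection. -/
theorem iUnion_ae_le_iInter {Ω : Type*} [MeasurableSpace Ω] {μ : Measure Ω} {E : ℤ → Set Ω}
    (h : ∀ k, E k =ᵐ[μ] E (k + 1)) : ∀ᵐ x ∂μ, x ∈ ⋃ k, E k → x ∈ ⋂ k, E k := by
  have h' : ∀ᵐ x ∂μ, ∀ k, x ∈ E k ↔ x ∈ E (k + 1) := ae_all_iff.2 fun k => (h k).mem_iff
  filter_upwards [h'] with x hx hU
  have key : ∀ k, x ∈ E k ↔ x ∈ E 0 := by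
    intro k
    induction k using Int.induction_on with
    | zero => rfl
    | succ i ih => rw [← hx, ih]
    | pred i ih => rw [hx, sub_add_cancel, ih]
  obtain ⟨k, hk⟩ := Set.mem_iUnion.1 hU
  exact Set.mem_iInter.2 fun j => (key j).2 ((key k).1 hk)

variable [Fintype A] [DiscreteMeasurableSpace A]

/-- Each ray set is the shift preimage of its neighbour, so all have the same finite measure; being
nested, they agree almost everywhere. -/
theorem rightLim_or_leftLim_ae_limSet (G : Set (List A)) {μ : Measure (ℤ → A)} [IsFiniteMeasure μ]
    (hμ : MeasurePreserving shift μ μ) :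
    ∀ᵐ x ∂μ, x ∈ (⋃ k, rightLim G k) ∪ (⋃ k, leftLim G k) → x ∈ limSet G := by
  have hr : ∀ k, rightLim G k =ᵐ[μ] rightLim G (k + 1) := fun k =>
    ae_eq_of_subset_of_measure_ge (rightLim_subset_succ G k)
      (by rw [← shift_preimage_rightLim,
        hμ.measure_preimage (measurableSet_rightLim G k).nullMeasurableSet])
      (measurableSet_rightLim G k).nullMeasurableSet (measure_ne_top _ _)
  have hl : ∀ k, leftLim G k =ᵐ[μ] leftLim G (k + 1) := fun k =>
    (ae_eq_of_subset_of_measure_ge (leftLim_succ_subset G k)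
      (by rw [← shift_preimage_leftLim,
        hμ.measure_preimage (measurableSet_leftLim G k).nullMeasurableSet])
      (measurableSet_leftLim G _).nullMeasurableSet (measure_ne_top _ _)).symm
  filter_upwards [iUnion_ae_le_iInter hr, iUnion_ae_le_iInter hl] with x h₁ h₂ h
  rcases h with h | h
  · rw [limSet_eq_iInter_rightLim]
    exact h₁ h
  · rw [limSet_eq_iInter_leftLim]
    exact h₂ h

variable [TopologicalSpace A] [DiscreteTopology A]

theorem measure_limSet_eq_one {G : Set (List A)} {μ : Measure (ℤ → A)} [IsProbabilityMeasure μ]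
    (hμ : MeasurePreserving shift μ μ) (h : μ (resSet G) = 1) : μ (limSet G) = 1 := by
  refine le_antisymm prob_le_one ?_
  rw [← h]
  refine measure_mono_ae ?_
  filter_upwards [rightLim_or_leftLim_ae_limSet G hμ] with x hx hres
  exact hx (resSet_subset G hres)

/-- The sets are compared almost everywhere, so measurability of `seqSet G` plays no role. -/
theorem measure_seqSet_eq_one {G : Set (List A)} {μ : Measure (ℤ → A)} [IsProbabilityMeasure μ]
    (hμ : MeasurePreserving shift μ μ) (h : μ (codedShift G) = 1) (h0 : μ (limSet G) = 0) :
    μ (seqSet G) = 1 := by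
  refine le_antisymm prob_le_one ?_
  rw [← h]
  refine measure_mono_ae ?_
  filter_upwards [rightLim_or_leftLim_ae_limSet G hμ, measure_eq_zero_iff_ae_notMem.1 h0]
    with x hx hlim hcod
  by_contra hseq
  exact hlim (hx (resSet_subset G ⟨hcod, hseq⟩))

end Recurrence

/-! ### Entropies of blocks and their subadditivity. -/

section BlockEntropy

variable {A : Type*} [Fintype A] [MeasurableSpace A]

theorem measureEntropy_eq (μ : Measure (ℤ → A)) : measureEntropy μ =
    limsup (fun n : ℕ => ((entropyOf μ (window 0 n) / n : ℝ) : EReal)) atTop := by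
  unfold measureEntropy entropyOf
  congr 1
  funext n
  congr 1
  simp only [cylinder_eq_preimage]
  ring

variable [DiscreteMeasurableSpace A]

theorem entropyOf_window_le_log_words (μ : Measure (ℤ → A)) [IsProbabilityMeasure μ]
    {Y : Set (ℤ → A)} (hY : μ Y = 1) (m : ℤ) (n : ℕ) :
    entropyOf μ (window m n) ≤ Real.log (words Y n).ncard := by
  classical
  rw [Set.ncard_eq_toFinset_card']
  refine entropyOf_le_log_card μ (fun w => measurableSet_window_preimage m n _) _ fun w hw => ?_
  rw [← prob_compl_eq_one_iff (measurableSet_window_preimage m n _)]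
  refine le_antisymm prob_le_one (hY ▸ measure_mono fun x hx hxw => hw ?_)
  rw [Set.mem_toFinset, ← (hxw : window m n x = w)]
  exact window_mem_words hx m n

/-- The part of the block entropy of `μ` coming from a set `Y`. -/
theorem entropyOf_restrict_window_le (μ : Measure (ℤ → A)) [IsFiniteMeasure μ]
    {Y : Set (ℤ → A)} (hY : MeasurableSet Y) (m : ℤ) (n : ℕ) :
    entropyOf (μ.restrict Y) (window m n) ≤
      μ.real Y * Real.log (words Y n).ncard + Real.negMulLog (μ.real Y) := by
  classical
  have h := sum_negMulLog_le (p := fun w => (μ.restrict Y).real (window m n ⁻¹' {w}))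
    (fun w => measureReal_nonneg) (words Y n).toFinset fun w hw => by
      rw [measureReal_restrict_apply' hY]
      have : window m n ⁻¹' {w} ∩ Y = ∅ := by
        rw [Set.eq_empty_iff_forall_notMem]
        rintro x ⟨hxw, hx⟩
        rw [Set.mem_toFinset, ← (hxw : window m n x = w)] at hw
        exact hw (window_mem_words hx m n)
      simp [this]
  rw [sum_real_preimage _ fun w => measurableSet_window_preimage m n _,
    measureReal_restrict_apply_univ, ← Set.ncard_eq_toFinset_card'] at h
  exact h

theorem entropyOf_window_le (μ : Measure (ℤ → A)) [IsProbabilityMeasure μ] (m : ℤ) (n : ℕ) :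
    entropyOf μ (window m n) ≤ n * Real.log (Fintype.card A) := by
  refine (entropyOf_le_log_card μ (fun w => measurableSet_window_preimage m n _) Finset.univ
    (by simp)).trans ?_
  simp

theorem entropyOf_window_add_le (μ : Measure (ℤ → A)) [IsProbabilityMeasure μ] (m : ℤ)
    (a b : ℕ) : entropyOf μ (window m (a + b)) ≤
      entropyOf μ (window m a) + entropyOf μ (window (m + a) b) := by
  let e : (Fin (a + b) → A) → (Fin a → A) × (Fin b → A) :=
    fun w => (fun j => w (Fin.castAdd b j), fun j => w (Fin.natAdd a j))
  have he : Function.Injective e := by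
    intro w w' h
    rw [Prod.mk.injEq] at h
    funext i
    exact Fin.addCases (fun j => congrFun h.1 j) (fun j => congrFun h.2 j) i
  rw [← entropyOf_comp_injective μ _ he]
  have : (fun x => e (window m (a + b) x)) = fun x => (window m a x, window (m + a) b x) := by
    funext x
    refine Prod.ext rfl ?_
    funext j
    simp [e, window, add_assoc]
  rw [this]
  exact entropyOf_prod_le μ (fun w => measurableSet_window_preimage m a _)
    fun w => measurableSet_window_preimage _ b _

theorem entropyOf_window_mul_le (μ : Measure (ℤ → A)) [IsProbabilityMeasure μ] (j q t : ℕ) :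
    entropyOf μ (window 0 (j + t * q)) ≤ entropyOf μ (window 0 j) +
      ∑ r ∈ Finset.range t, entropyOf μ (window ((j + r * q : ℕ) : ℤ) q) := by
  induction t with
  | zero => rw [show j + 0 * q = j by simp, Finset.sum_range_zero, add_zero]
  | succ t ih =>
    rw [Finset.sum_range_succ, show j + (t + 1) * q = (j + t * q) + q by ring]
    have := entropyOf_window_add_le μ 0 (j + t * q) q
    rw [zero_add] at this
    linarith

theorem entropyOf_map {Ω Ω' B : Type*} [MeasurableSpace Ω] [MeasurableSpace Ω'] [Fintype B]
    (μ : Measure Ω) {g : Ω → Ω'} (hg : Measurable g) {f : Ω' → B}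
    (hf : ∀ b, MeasurableSet (f ⁻¹' {b})) :
    entropyOf (μ.map g) f = entropyOf μ fun x => f (g x) := by
  unfold entropyOf
  refine Finset.sum_congr rfl fun b _ => ?_
  rw [map_measureReal_apply hg (hf b)]
  rfl

theorem entropyOf_map_translate (μ : Measure (ℤ → A)) (m k : ℤ) (n : ℕ) :
    entropyOf (μ.map (translate k)) (window m n) = entropyOf μ (window (m + k) n) := by
  rw [entropyOf_map μ (measurable_translate k) fun w => measurableSet_window_preimage m n _]
  simp only [window_translate]

theorem entropyOf_window_of_invariant {μ : Measure (ℤ → A)} (hμ : MeasurePreserving shift μ μ)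
    (m n : ℕ) : entropyOf μ (window m n) = entropyOf μ (window 0 n) := by
  induction m with
  | zero => simp
  | succ m ih =>
    rw [← ih]
    conv_rhs => rw [← hμ.map_eq]
    exact (entropyOf_map_translate μ m 1 n).symm

theorem subadditive_entropyOf_window {μ : Measure (ℤ → A)} [IsProbabilityMeasure μ]
    (hμ : MeasurePreserving shift μ μ) : Subadditive fun n => entropyOf μ (window 0 n) := by
  intro a b
  have := entropyOf_window_add_le μ 0 a b
  rwa [zero_add, entropyOf_window_of_invariant hμ] at this

end BlockEntropy

/-! ### Misiurewicz's construction of a measure of maximal entropy. -/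

section MaximalEntropy

variable {A : Type*} [Fintype A] [MeasurableSpace A] [DiscreteMeasurableSpace A]

theorem sum_range_sum_range_mul (f : ℕ → ℝ) (q t : ℕ) :
    ∑ j ∈ Finset.range q, ∑ r ∈ Finset.range t, f (j + r * q) =
      ∑ p ∈ Finset.range (t * q), f p := by
  rw [Finset.sum_comm]
  induction t with
  | zero => simp
  | succ t ih =>
    rw [Finset.sum_range_succ, ih, add_mul, one_mul, Finset.sum_range_add]
    simp only [add_comm]

/-- The averaging estimate in Misiurewicz's proof of the variational principle. -/
theorem mul_log_card_le (ν : Measure (ℤ → A)) [IsProbabilityMeasure ν] {L : ℝ}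
    {n : ℕ} (hL : ∀ n', n ≤ n' → L ≤ entropyOf ν (window 0 n')) (q : ℕ) :
    q * L ≤ 2 * (q * (q * Real.log (Fintype.card A))) +
      ∑ p ∈ Finset.range n, entropyOf ν (window (p : ℕ) q) := by
  rcases Nat.eq_zero_or_pos q with rfl | hq
  · have : ∀ p ∈ Finset.range n, 0 ≤ entropyOf ν (window (p : ℕ) 0) := fun p _ =>
      Finset.sum_nonneg fun b _ => Real.negMulLog_nonneg measureReal_nonneg measureReal_le_one
    simpa using Finset.sum_nonneg this
  set K := (q : ℝ) * Real.log (Fintype.card A) with hK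
  have hlog : 0 ≤ Real.log (Fintype.card A) := Real.log_natCast_nonneg _
  have hK0 : 0 ≤ K := by positivity
  set a : ℕ → ℝ := fun p => entropyOf ν (window (p : ℕ) q) with ha
  have haK : ∀ p, a p ≤ K := fun p => entropyOf_window_le ν p q
  have ha0 : ∀ p, 0 ≤ a p := fun p =>
    Finset.sum_nonneg fun b _ => Real.negMulLog_nonneg measureReal_nonneg measureReal_le_one
  -- From every offset `j`, the prefix of length `j` and `t` blocks of length `q` cover `[0, n)`,
  -- while `t * q` exceeds `n` by at most `q`.
  set t := n / q + 1 with ht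
  have h1 : n ≤ t * q := by
    have := Nat.lt_div_mul_add hq (a := n)
    rw [ht, add_mul]
    omega
  have h2 : t * q ≤ n + q := by
    have := Nat.div_mul_le_self n q
    rw [ht, add_mul]
    omega
  -- The prefix of length `j < q` costs at most `K`. Summing over the offsets `j` uses each position
  -- below `t * q` exactly once.
  have hj : ∀ j ∈ Finset.range q, L ≤ K + ∑ r ∈ Finset.range t, a (j + r * q) := by
    intro j hj
    have hjq : (j : ℝ) ≤ q := by exact_mod_cast (Finset.mem_range.1 hj).le
    calc L ≤ entropyOf ν (window 0 (j + t * q)) := hL _ (by omega)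
      _ ≤ _ := entropyOf_window_mul_le ν j q t
      _ ≤ _ := by
        have := (entropyOf_window_le ν 0 j).trans (mul_le_mul_of_nonneg_right hjq hlog)
        gcongr
  have hsum := Finset.sum_le_sum hj
  rw [Finset.sum_add_distrib, sum_range_sum_range_mul] at hsum
  simp only [Finset.sum_const, Finset.card_range, nsmul_eq_mul] at hsum
  -- At most `q` positions lie beyond `n`, each costing at most `K`; with the prefixes this gives
  -- the error `2 * q * K`.
  have htail : ∑ p ∈ Finset.range (t * q), a p ≤ ∑ p ∈ Finset.range n, a p + q * K := by
    rw [← Finset.sum_range_add_sum_Ico _ h1]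
    gcongr
    refine (Finset.sum_le_sum fun p _ => haK p).trans ?_
    rw [Finset.sum_const, Nat.card_Ico, nsmul_eq_mul]
    gcongr
    omega
  linarith

/-- An almost invariant measure with almost maximal block entropies. -/
theorem exists_almost_invariant {X : Set (ℤ → A)} (hX : X.Nonempty)
    (htr : ∀ m : ℤ, ∀ x ∈ X, translate m x ∈ X) {n : ℕ} (hn : n ≠ 0) :
    ∃ ν : Measure (ℤ → A), IsProbabilityMeasure ν ∧
      ∀ μ : Measure (ℤ → A), μ = avgMeasure (Finset.range n) (fun p => ν.map (translate (p : ℕ))) →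
        μ X = 1 ∧ ∀ q : ℕ, q * Real.log (words X n).ncard ≤
          2 * (q * (q * Real.log (Fintype.card A))) + n * entropyOf μ (window 0 q) := by
  classical
  have hz : ∀ w : words X n, ∃ z ∈ X, window 0 n z = w := by
    rintro ⟨w, x, hx, m, hw⟩
    refine ⟨translate m x, htr m x hx, ?_⟩
    rw [window_translate]
    funext j
    simpa [window] using hw j
  choose z hzX hzw using hz
  have : Nonempty (words X n) := hX.elim fun x hx => ⟨⟨_, window_mem_words hx 0 n⟩⟩
  let ν := avgMeasure Finset.univ fun w => Measure.dirac (z w)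
  have hν : IsProbabilityMeasure ν := avgMeasure_isProbabilityMeasure Finset.univ_nonempty
  refine ⟨ν, hν, ?_⟩
  rintro μ rfl
  have hne : (Finset.range n).Nonempty := by simpa using hn
  have hpr : ∀ p : ℕ, IsProbabilityMeasure (ν.map (translate (p : ℕ))) := fun p =>
    Measure.isProbabilityMeasure_map (measurable_translate _).aemeasurable
  constructor
  · refine avgMeasure_eq_one hne fun p _ => le_antisymm prob_le_one ?_
    have h1 : ν (translate (p : ℕ) ⁻¹' X) = 1 :=
      avgMeasure_eq_one Finset.univ_nonempty fun w _ => le_antisymm prob_le_one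
        (Measure.dirac_apply_of_mem (s := translate (p : ℕ) ⁻¹' X) (htr p _ (hzX w))).ge
    rw [← h1]
    -- This inequality holds for arbitrary sets; `X` is not assumed measurable here.
    exact Measure.le_map_apply (measurable_translate _).aemeasurable X
  · intro q
    -- Windows longer than `n` still separate the chosen points, which allows the overshoot in
    -- `mul_log_card_le`.
    have hL : ∀ n', n ≤ n' → Real.log (words X n).ncard ≤ entropyOf ν (window 0 n') := by
      intro n' hn'
      rw [entropyOf_uniform z fun b => measurableSet_window_preimage 0 n' _,
        Set.ncard_eq_toFinset_card', Set.toFinset_card]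
      intro w w' h
      refine Subtype.ext ?_
      rw [← hzw w, ← hzw w']
      funext j
      exact congrFun h (Fin.castLE hn' j)
    refine (mul_log_card_le ν hL q).trans ?_
    have := sum_entropyOf_le_avgMeasure hne (ν := fun p => ν.map (translate (p : ℕ)))
      (window 0 q)
    simp only [entropyOf_map_translate, zero_add, Finset.card_range] at this
    gcongr

variable [TopologicalSpace A] [DiscreteTopology A]

/-- Shifting the average telescopes, leaving only the two end terms. -/
theorem abs_integral_avg_shift_le {ν : Measure (ℤ → A)} [IsProbabilityMeasure ν] {n : ℕ}
    (hn : n ≠ 0) (f : BoundedContinuousFunction (ℤ → A) ℝ) {μ : Measure (ℤ → A)}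
    (hμ : μ = avgMeasure (Finset.range n) fun p => ν.map (translate (p : ℕ))) :
    |∫ x, f (shift x) ∂μ - ∫ x, f x ∂μ| ≤ 2 * ‖f‖ / n := by
  have hpr : ∀ p : ℕ, IsProbabilityMeasure (ν.map (translate (p : ℕ))) := fun p =>
    Measure.isProbabilityMeasure_map (measurable_translate _).aemeasurable
  have hint : ∀ g : BoundedContinuousFunction (ℤ → A) ℝ,
      ∫ x, g x ∂μ = (n : ℝ)⁻¹ * ∑ p ∈ Finset.range n, ∫ x, g (translate (p : ℕ) x) ∂ν := by
    intro g
    rw [hμ, avgMeasure, integral_smul_measure,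
      integral_finsetSum_measure fun p _ => g.integrable _]
    simp only [Finset.card_range, ENNReal.toReal_inv, ENNReal.toReal_natCast, smul_eq_mul]
    congr 1
    refine Finset.sum_congr rfl fun p _ => ?_
    rw [integral_map (measurable_translate _).aemeasurable
      g.continuous.measurable.aestronglyMeasurable]
  have hst : ∀ (p : ℕ) (x : ℤ → A),
      shift (translate (p : ℕ) x) = translate ((p + 1 : ℕ) : ℤ) x := by
    intro p x
    funext i
    simp only [shift, translate]
    congr 1
    push_cast
    ring
  have hs : ∫ x, f (shift x) ∂μ =
      (n : ℝ)⁻¹ * ∑ p ∈ Finset.range n, ∫ x, f (translate ((p + 1 : ℕ) : ℤ) x) ∂ν := by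
    simp only [← hst]
    exact hint (f.compContinuous ⟨shift, continuous_shift⟩)
  have hb : ∀ p : ℕ, |∫ x, f (translate (p : ℕ) x) ∂ν| ≤ ‖f‖ := by
    intro p
    have := norm_integral_le_of_norm_le_const (μ := ν) (C := ‖f‖)
      (Eventually.of_forall fun x => f.norm_coe_le_norm (translate (p : ℕ) x))
    simpa using this
  rw [hs, hint f, ← mul_sub, ← Finset.sum_sub_distrib,
    Finset.sum_range_sub fun p : ℕ => ∫ x, f (translate (p : ℕ) x) ∂ν, abs_mul,
    abs_of_nonneg (by positivity), div_eq_inv_mul]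
  gcongr
  refine (abs_sub _ _).trans ?_
  linarith [hb n, hb 0]

/-- Existence of an invariant measure whose block entropies dominate the exponential growth rate
of the number of words. -/
theorem exists_invariantMeasure_entropy_ge {X : Set (ℤ → A)} (hX : X.Nonempty)
    (hcl : IsClosed X) (htr : ∀ m : ℤ, ∀ x ∈ X, translate m x ∈ X) {T : ℝ}
    (hT : ∀ n : ℕ, n ≠ 0 → T * n ≤ Real.log (words X n).ncard) :
    ∃ μ ∈ invariantMeasures X, ∀ q : ℕ, T * q ≤ entropyOf μ (window 0 q) := by
  choose ν hν hμ using fun n : ℕ => exists_almost_invariant hX htr n.succ_ne_zero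
  let μs : ℕ → ProbabilityMeasure (ℤ → A) := fun n =>
    ⟨avgMeasure (Finset.range (n + 1)) (fun p => (ν n).map (translate (p : ℕ))), by
      have : ∀ p : ℕ, IsProbabilityMeasure ((ν n).map (translate (p : ℕ))) := fun p =>
        Measure.isProbabilityMeasure_map (measurable_translate _).aemeasurable
      exact avgMeasure_isProbabilityMeasure (by simp)⟩
  -- Compactness of the space of probability measures gives a limit along an ultrafilter, with no
  -- passage to subsequences.
  let U : Ultrafilter ℕ := hyperfilter ℕ
  have hU : (U : Filter ℕ) ≤ atTop := Nat.hyperfilter_le_atTop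
  obtain ⟨μ, -, hlim⟩ := isCompact_univ.ultrafilter_le_nhds (U.map μs) (by simp)
  replace hlim : Tendsto μs U (nhds μ) := hlim

  refine ⟨μ, ⟨inferInstance, ⟨measurable_shift, ?_⟩, ?_⟩, fun q => ?_⟩
  · have : IsProbabilityMeasure ((μ : Measure (ℤ → A)).map shift) :=
      Measure.isProbabilityMeasure_map measurable_shift.aemeasurable
    refine ext_of_forall_integral_eq_of_IsFiniteMeasure fun f => ?_
    rw [integral_map measurable_shift.aemeasurable
      f.continuous.measurable.aestronglyMeasurable]
    have h := ProbabilityMeasure.tendsto_iff_forall_integral_tendsto.1 hlim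
    have h1 := h f
    have h2 : Tendsto (fun n => ∫ x, f (shift x) ∂(μs n : Measure (ℤ → A))) U
        (nhds (∫ x, f (shift x) ∂(μ : Measure (ℤ → A)))) :=
      h (f.compContinuous ⟨shift, continuous_shift⟩)
    have h3 : Tendsto (fun n : ℕ => 2 * ‖f‖ / ((n + 1 : ℕ) : ℝ)) U (nhds 0) :=
      (((tendsto_natCast_atTop_atTop (R := ℝ)).comp (tendsto_add_atTop_nat 1)).const_div_atTop
        (2 * ‖f‖)).mono_left hU
    have h4 : Tendsto (fun n => ∫ x, f (shift x) ∂(μs n : Measure (ℤ → A)) -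
        ∫ x, f x ∂(μs n : Measure (ℤ → A))) U (nhds 0) :=
      squeeze_zero_norm (fun n => abs_integral_avg_shift_le n.succ_ne_zero f
        (rfl : (μs n : Measure (ℤ → A)) = _)) h3
    exact sub_eq_zero.1 (tendsto_nhds_unique (h2.sub h1) h4)
  · refine le_antisymm prob_le_one ?_
    have h := ProbabilityMeasure.limsup_measure_closed_le_of_tendsto hlim hcl
    have h1 : ∀ n, (μs n : Measure (ℤ → A)) X = 1 := fun n => (hμ n _ rfl).1
    simpa only [h1, limsup_const] using h
  -- Cylinders are clopen, so their masses converge, and for fixed `q` the block entropy is a finite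
  -- continuous expression in them.
  · have hcyl : ∀ w : Fin q → A, Tendsto
        (fun n => (μs n : Measure (ℤ → A)).real (window 0 q ⁻¹' {w})) U
        (nhds ((μ : Measure (ℤ → A)).real (window 0 q ⁻¹' {w}))) := by
      intro w
      have := ProbabilityMeasure.tendsto_measure_of_isClopen_of_tendsto hlim
        ((isClopen_discrete {w}).preimage (continuous_window 0 q))
      exact (NNReal.continuous_coe.tendsto _).comp this
    have hent : Tendsto (fun n => entropyOf (μs n : Measure (ℤ → A)) (window 0 q)) U
        (nhds (entropyOf (μ : Measure (ℤ → A)) (window 0 q))) :=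
      tendsto_finsetSum _ fun w _ => (Real.continuous_negMulLog.tendsto _).comp (hcyl w)
    set K := 2 * (q * (q * Real.log (Fintype.card A))) with hK
    have h3 : Tendsto (fun n : ℕ => K / ((n + 1 : ℕ) : ℝ)) U (nhds 0) :=
      (((tendsto_natCast_atTop_atTop (R := ℝ)).comp (tendsto_add_atTop_nat 1)).const_div_atTop
        K).mono_left hU
    have h4 := h3.add hent
    rw [zero_add] at h4
    refine ge_of_tendsto' h4 fun n => ?_
    have h5 := (hμ n _ rfl).2 q
    have h6 := hT (n + 1) n.succ_ne_zero
    have h7 : (0 : ℝ) < ((n + 1 : ℕ) : ℝ) := by positivity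
    change _ ≤ K / ((n + 1 : ℕ) : ℝ) + entropyOf (avgMeasure _ _) _
    rw [← sub_le_iff_le_add, le_div_iff₀ h7]
    have h8 := mul_le_mul_of_nonneg_left h6 (Nat.cast_nonneg (α := ℝ) q)
    linarith

end MaximalEntropy

/-! ### Comparison of the entropies. -/

section Entropies

variable {A : Type*} [Fintype A]

theorem log_encard_words_div {Y : Set (ℤ → A)} {n : ℕ} (h : Y.Nonempty) :
    ENNReal.log ((words Y n).encard : ℝ≥0∞) / (n : EReal) =
      ((Real.log (words Y n).ncard / n : ℝ) : EReal) := by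
  have hfin : (words Y n).Finite := Set.toFinite _
  have hne : (words Y n).Nonempty := h.elim fun x hx => ⟨_, window_mem_words hx 0 n⟩
  have h0 : (words Y n).ncard ≠ 0 := ((Set.ncard_pos hfin).2 hne).ne'
  rw [← hfin.cast_ncard_eq, EReal.coe_div]
  congr 1
  rw [ENat.toENNReal_coe, ENNReal.log_pos_real (by simpa using h0) (ENNReal.natCast_ne_top _)]
  simp

variable [MeasurableSpace A]

theorem le_measureEntropy {μ : Measure (ℤ → A)} {T D : ℝ}
    (h : ∀ᶠ n : ℕ in atTop, T * n - D ≤ entropyOf μ (window 0 n)) :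
    (T : EReal) ≤ measureEntropy μ := by
  have h1 : Tendsto (fun n : ℕ => T - D / (n : ℝ)) atTop (nhds T) := by
    simpa using (tendsto_natCast_atTop_atTop (R := ℝ)).const_div_atTop D |>.const_sub T
  have h2 := (continuous_coe_real_ereal.tendsto T).comp h1
  rw [measureEntropy_eq, ← h2.limsup_eq]
  refine limsup_le_limsup ?_
  filter_upwards [h, eventually_gt_atTop 0] with n hn hn0
  have hn0' : (0 : ℝ) < n := Nat.cast_pos.2 hn0
  simp only [Function.comp_apply, EReal.coe_le_coe_iff]
  rw [le_div_iff₀ hn0']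
  have : (T - D / n) * n = T * n - D := by field_simp
  linarith

variable [DiscreteMeasurableSpace A]

theorem measureEntropy_le_wordEntropy {μ : Measure (ℤ → A)} [IsProbabilityMeasure μ]
    {Y : Set (ℤ → A)} (hY : μ Y = 1) : measureEntropy μ ≤ wordEntropy Y := by
  have hne : Y.Nonempty := nonempty_of_measure_ne_zero (μ := μ) (by simp [hY])
  rw [measureEntropy_eq, wordEntropy]
  refine limsup_le_limsup (Eventually.of_forall fun n => ?_)
  simp only [log_encard_words_div hne]
  rw [EReal.coe_le_coe_iff]
  gcongr
  exact entropyOf_window_le_log_words μ hY 0 n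

/-- Fekete's lemma: block entropies of an invariant measure are subadditive. -/
theorem measureEntropy_le_div {μ : Measure (ℤ → A)} [IsProbabilityMeasure μ]
    (hμ : MeasurePreserving shift μ μ) {n : ℕ} (hn : n ≠ 0) :
    measureEntropy μ ≤ ((entropyOf μ (window 0 n) / n : ℝ) : EReal) := by
  rw [measureEntropy_eq]
  refine EReal.le_of_forall_lt_iff_le.1 fun z hz => ?_
  have := (subadditive_entropyOf_window hμ).eventually_div_lt_of_div_lt hn
    (EReal.coe_lt_coe_iff.1 hz)
  refine limsup_le_of_le (by isBoundedDefault) ?_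
  filter_upwards [this] with p hp
  exact EReal.coe_le_coe_iff.2 hp.le

theorem measureEntropy_le_topEntropy {μ : Measure (ℤ → A)} {X : Set (ℤ → A)}
    (hμ : μ ∈ invariantMeasures X) : measureEntropy μ ≤ topEntropy X := by
  obtain ⟨hp, hinv, hX⟩ := hμ
  have hne : X.Nonempty := nonempty_of_measure_ne_zero (μ := μ) (by simp [hX])
  refine le_iInf₂ fun n hn => (measureEntropy_le_div hinv (by omega : n ≠ 0)).trans ?_
  rw [log_encard_words_div hne, EReal.coe_le_coe_iff]
  gcongr
  exact entropyOf_window_le_log_words μ hX 0 n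

/-- Removing an invariant set of small entropy from a measure of large entropy, and normalizing. -/
theorem exists_invariant_complement_entropy_ge {X L : Set (ℤ → A)} (hX : MeasurableSet X)
    (hL : MeasurableSet L) (hLinv : shift ⁻¹' L = L) {μ : Measure (ℤ → A)}
    (hμ : μ ∈ invariantMeasures X) {T c : ℝ} (hc : c < T)
    (hT : ∀ n : ℕ, T * n ≤ entropyOf μ (window 0 n))
    (hLc : ∀ᶠ n : ℕ in atTop, μ.real L * Real.log (words L n).ncard ≤ μ.real L * (c * n)) :
    ∃ ν ∈ invariantMeasures X, ν L = 0 ∧ (T : EReal) ≤ measureEntropy ν := by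
  obtain ⟨hp, hinv, hμX⟩ := hμ
  set a := μ.real L with ha
  have ha0 : 0 ≤ a := measureReal_nonneg
  have hac : μ.real Lᶜ = 1 - a := by rw [measureReal_compl hL, probReal_univ]
  have hsplit : ∀ᶠ n : ℕ in atTop, T * n ≤ a * (c * n) + Real.negMulLog a +
      entropyOf (μ.restrict Lᶜ) (window 0 n) := by
    filter_upwards [hLc] with n hn
    have h1 := entropyOf_le_inter_add_inter μ (f := window 0 n) hL
    have h2 := entropyOf_restrict_window_le μ hL 0 n
    linarith [hT n]
  -- If `L` had full mass, both entropy corrections would vanish and `T * n ≤ c * n` would hold for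
  -- some positive `n`.
  have hcompl : μ Lᶜ ≠ 0 := by
    intro h0
    have ha1 : a = 1 := by
      have : μ.real Lᶜ = 0 := by simp [Measure.real, h0]
      linarith
    obtain ⟨n, hn, hn0⟩ := (hsplit.and (eventually_gt_atTop 0)).exists
    have hz : entropyOf (μ.restrict Lᶜ) (window 0 n) = 0 := by
      simp [Measure.restrict_eq_zero.2 h0, entropyOf]
    rw [hz, ha1, Real.negMulLog_one] at hn
    have hn0' : (0 : ℝ) < n := Nat.cast_pos.2 hn0
    nlinarith [mul_lt_mul_of_pos_right hc hn0']
  let ρ := μ.restrict Lᶜ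
  have hρu : ρ Set.univ = μ Lᶜ := Measure.restrict_apply_univ _
  have hρr : ρ.real Set.univ = 1 - a := by rw [Measure.real, hρu, ← hac, Measure.real]
  let ν := (ρ Set.univ)⁻¹ • ρ
  have hνp : IsProbabilityMeasure ν := ⟨by
    simp only [ν, Measure.smul_apply, smul_eq_mul, hρu]
    exact ENNReal.inv_mul_cancel hcompl (measure_ne_top _ _)⟩
  have hνX : ν Xᶜ = 0 := by
    have : μ Xᶜ = 0 := (prob_compl_eq_zero_iff hX).2 hμX
    simp only [ν, Measure.smul_apply, smul_eq_mul]
    rw [show ρ Xᶜ = 0 from le_antisymm ((Measure.restrict_apply_le _ _).trans this.le) bot_le,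
      mul_zero]
  refine ⟨ν, ⟨hνp, ?_, (prob_compl_eq_zero_iff hX).1 hνX⟩, ?_, ?_⟩
  · have h := hinv.restrict_preimage hL.compl
    rw [Set.preimage_compl, hLinv] at h
    exact h.smul_measure _
  · simp only [ν, ρ, Measure.smul_apply, smul_eq_mul, Measure.restrict_apply hL,
      Set.inter_compl_self, measure_empty, mul_zero]
  · have hpos : 0 < 1 - a := by
      rw [← hac]
      exact ENNReal.toReal_pos hcompl (measure_ne_top _ _)
    -- Replacing `c` by `T`, the splitting bounds `(1 - a) * T * n` by `(1 - a)` times the block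
    -- entropy of `ν` plus two constants; division by `1 - a` gives `D`.
    refine le_measureEntropy (D := (Real.negMulLog a + Real.negMulLog (1 - a)) / (1 - a)) ?_
    filter_upwards [hsplit] with n hn
    have h := entropyOf_eq_mul_smul ρ (f := window 0 n)
      (fun w => measurableSet_window_preimage 0 n _) (by rwa [hρu])
    rw [hρr] at h
    have h' : entropyOf (μ.restrict Lᶜ) (window 0 n) =
      (1 - a) * entropyOf ν (window 0 n) + Real.negMulLog (1 - a) := h
    have hTc : a * (c * n) ≤ a * (T * n) := by gcongr
    rw [sub_le_iff_le_add, ← sub_le_iff_le_add', le_div_iff₀ hpos]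
    nlinarith

variable [TopologicalSpace A] [DiscreteTopology A]

theorem resEntropy_le (G : Set (List A)) : resEntropy G ≤ wordEntropy (limSet G) := by
  refine iSup₂_le fun μ hμ => ?_
  obtain ⟨⟨hp, hinv, -⟩, hres⟩ := hμ
  exact measureEntropy_le_wordEntropy (measure_limSet_eq_one hinv hres)

theorem topEntropy_le_seqEntropy {G : Set (List A)}
    (hlim : wordEntropy (limSet G) < topEntropy (codedShift G)) :
    topEntropy (codedShift G) ≤ seqEntropy G := by
  have hX : (codedShift G).Nonempty := by
    by_contra h
    rw [Set.not_nonempty_iff_eq_empty] at h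
    -- For an empty coded shift the term `n = 1` of the infimum is already `-∞`.
    refine (bot_le.trans_lt hlim).ne' (le_bot_iff.1 ((iInf₂_le 1 le_rfl).trans ?_))
    have : words (∅ : Set (ℤ → A)) 1 = ∅ := by
      ext w
      simp [words]
    simp [h, this]
  have hle : ∀ n : ℕ, n ≠ 0 → topEntropy (codedShift G) ≤
      ((Real.log (words (codedShift G) n).ncard / n : ℝ) : EReal) := by
    intro n hn
    rw [← log_encard_words_div hX]
    exact iInf₂_le n (by omega)
  obtain ⟨c, hc, hcT⟩ := EReal.lt_iff_exists_real_btwn.1 hlim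
  have htop : topEntropy (codedShift G) ≠ ⊤ :=
    ((hle 1 one_ne_zero).trans_lt (EReal.coe_lt_top _)).ne
  lift topEntropy (codedShift G) to ℝ using ⟨htop, hcT.ne_bot⟩ with T hTdef
  rw [EReal.coe_lt_coe_iff] at hcT
  have hcl : IsClosed (codedShift G) := isClosed_closure
  obtain ⟨μ, hμ, hμT⟩ := exists_invariantMeasure_entropy_ge hX hcl
    (fun m x hx => translate_mem_codedShift hx m) (T := T) fun n hn => by
      have := EReal.coe_le_coe_iff.1 (hle n hn)
      rwa [le_div_iff₀ (Nat.cast_pos.2 (Nat.pos_of_ne_zero hn))] at this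
  -- The factor `μ.real (limSet G)` covers an empty limit set: there the real logarithm of `0` is
  -- `0`, whereas `c` may be negative.
  have hLc : ∀ᶠ n : ℕ in atTop,
      μ.real (limSet G) * Real.log (words (limSet G) n).ncard ≤ μ.real (limSet G) * (c * n) := by
    rcases (limSet G).eq_empty_or_nonempty with h | h
    · simp [h]
    · filter_upwards [eventually_lt_of_limsup_lt hc, eventually_gt_atTop 0] with n hn hn0
      rw [log_encard_words_div h, EReal.coe_lt_coe_iff,
        div_lt_iff₀ (Nat.cast_pos.2 hn0)] at hn
      exact mul_le_mul_of_nonneg_left hn.le measureReal_nonneg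
  obtain ⟨ν, hν, hνL, hνT⟩ := exists_invariant_complement_entropy_ge hcl.measurableSet
    (measurableSet_limSet G) (shift_preimage_limSet G) hμ hcT hμT hLc
  have := hν.1
  exact hνT.trans (le_iSup₂_of_le ν ⟨hν, measure_seqSet_eq_one hν.2.1 hν.2.2 hνL⟩ le_rfl)

end Entropies

end CodedShift

theorem mainTheorem5 {A : Type*} [Fintype A] [TopologicalSpace A] [DiscreteTopology A]
    [MeasurableSpace A] [DiscreteMeasurableSpace A] (G : Set (List A))
    (hG : CodedShift.UniquelyRepresents G)
    (hlim : CodedShift.wordEntropy (CodedShift.limSet G) <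
      CodedShift.topEntropy (CodedShift.codedShift G)) :
    CodedShift.resEntropy G ≤ CodedShift.wordEntropy (CodedShift.limSet G) ∧
    CodedShift.wordEntropy (CodedShift.limSet G) < CodedShift.seqEntropy G ∧
    CodedShift.seqEntropy G = CodedShift.topEntropy (CodedShift.codedShift G) ∧
    CodedShift.resEntropy G < CodedShift.seqEntropy G := by
  have hres := CodedShift.resEntropy_le G
  have hseq : CodedShift.seqEntropy G = CodedShift.topEntropy (CodedShift.codedShift G) :=
    le_antisymm (iSup₂_le fun μ hμ => CodedShift.measureEntropy_le_topEntropy hμ.1)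
      (CodedShift.topEntropy_le_seqEntropy hlim)
  rw [hseq]
  exact ⟨hres, hlim, rfl, hres.trans_lt hlim⟩
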